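/- Let $(\Omega,\mathcal F,\mu)$ be a probability space, let $(\mathcal F_n)_{n\ge 0}$ be an increasing sequence of sub-$\sigma$-fields of $\mathcal F$, and let $\omega$ be a weight, i.e. an integrable random variable with $\omega>0$ almost surely. Write $\omega_n=\mathbb E(\omega|\mathcal F_n)$, let $\mathbb E_\omega(\cdot|\mathcal F_n)$ be the conditional expectation with respect to the measure $\omega\,d\mu$, and let $M_n^*(\omega)=\sup_{m\ge n}|\omega_m|$ be the tailed Doob maximal function. Conditional expectations of non-negative functions take values in $[0,\infty]$, $\mathbb E(\log\omega|\mathcal F_n)=\mathbb E(\log^+\omega|\mathcal F_n)-\mathbb E(\log^-\omega|\mathcal F_n)$ takes values in $[-\infty,\infty)$, and $\exp(-\infty)=0$. Suppose that at least one of the following holds: 1. $\omega\in\bigcup_{p>1}A_p$: there are $p>1$ and $C<\infty$ such that for all $n\ge 0$, $\ \omega_n\,\mathbb E(\omega^{-1/(p-1)}|\mathcal F_n)^{p-1}\le C$ a.s.; 2. $\omega\in\bigcup_{q>1}RH_q$: there are $q>1$ and $C<\infty$ such that for all $n\ge 0$, $\ \mathbb E(\omega^q|\mathcal F_n)\le C\,\omega_n^q$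 a.s.; 3. $\omega\in A_\infty^{\log}$: there is $C<\infty$ such that for all $n\ge 0$, $\ \mathbb E_\omega\big(\log^+\frac{\omega}{\omega_n}\big|\mathcal F_n\big)\le C$ a.s.; 4. $\omega\in A_\infty^{\exp}$: there is $C<\infty$ such that for all $n\ge 0$, $\ \omega_n\le C\exp\mathbb E(\log\omega|\mathcal F_n)$ a.s. Then $\omega\in A_\infty^*$: there is $C<\infty$ such that for all $n\ge 0$, $\ \mathbb E(M_n^*(\omega)|\mathcal F_n)\le C\,\omega_n$ a.s. In particular $A_\infty^{\exp}\subseteq A_\infty^*$. -/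

import Mathlib

open MeasureTheory ProbabilityTheory
open scoped ENNReal NNReal

namespace MartingaleWeights

variable {Ω : Type*} {mΩ : MeasurableSpace Ω}

/-- A weight: an integrable random variable that is positive almost surely. -/
structure IsWeight (μ : Measure Ω) (w : Ω → ℝ) : Prop where
  integrable : Integrable w μ
  pos : ∀ᵐ x ∂μ, 0 < w x

/-- The martingale `f_n = E(f | F_n)` generated by an integrable function `f`. -/
noncomputable def mart (μ : Measure Ω) (ℱ : Filtration ℕ mΩ) (f : Ω → ℝ) (n : ℕ) : Ω → ℝ :=
  condExp (ℱ n) μ f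

/-- The conditional expectation `E(f | F_n)` of a `[0, ∞]`-valued function, with values in
`[0, ∞]`, so that no integrability is needed. -/
noncomputable def condE (μ : Measure Ω) (ℱ : Filtration ℕ mΩ) (n : ℕ) (f : Ω → ℝ≥0∞) :
    Ω → ℝ≥0∞ :=
  condLExp (ℱ n) μ f

/-- The weighted measure `w dμ`. -/
noncomputable def weighted (μ : Measure Ω) (w : Ω → ℝ) : Measure Ω :=
  μ.withDensity (fun x => ENNReal.ofReal (w x))

/-- The tailed maximal operator `M*_n f = sup_{m ≥ n} |f_m|`. -/
noncomputable def tailedMax (μ : Measure Ω) (ℱ : Filtration ℕ mΩ) (n : ℕ) (f : Ω → ℝ) :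
    Ω → ℝ≥0∞ :=
  fun x => ⨆ (m : ℕ) (_ : n ≤ m), ENNReal.ofReal |mart μ ℱ f m x|

/-- `w ∈ A_p`: `E(w | F_n) * E(w ^ (-1/(p-1)) | F_n) ^ (p-1) ≤ C` for all `n`. -/
def MemAp (μ : Measure Ω) (ℱ : Filtration ℕ mΩ) (p : ℝ) (w : Ω → ℝ) : Prop :=
  ∃ C : ℝ≥0, ∀ n : ℕ, ∀ᵐ x ∂μ,
    ENNReal.ofReal (mart μ ℱ w n x) *
      (condE μ ℱ n (fun y => ENNReal.ofReal (w y) ^ (-(1 / (p - 1)))) x) ^ (p - 1) ≤ C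

/-- `w ∈ RH_q`: the reverse Hölder condition `E(w ^ q | F_n) ≤ C * E(w | F_n) ^ q` for all `n`. -/
def MemRH (μ : Measure Ω) (ℱ : Filtration ℕ mΩ) (q : ℝ) (w : Ω → ℝ) : Prop :=
  ∃ C : ℝ≥0, ∀ n : ℕ, ∀ᵐ x ∂μ,
    condE μ ℱ n (fun y => ENNReal.ofReal (w y) ^ q) x ≤
      C * ENNReal.ofReal (mart μ ℱ w n x) ^ q

/-- `w ∈ A_∞^log`: `E_w(log⁺ (w / w_n) | F_n) ≤ C` for all `n`, where `E_w(· | F_n)` is the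
conditional expectation with respect to the measure `w dμ`. -/
def MemALog (μ : Measure Ω) (ℱ : Filtration ℕ mΩ) (w : Ω → ℝ) : Prop :=
  ∃ C : ℝ≥0, ∀ n : ℕ, ∀ᵐ x ∂μ,
    condE (weighted μ w) ℱ n
      (fun y => ENNReal.ofReal (Real.posLog (w y / mart μ ℱ w n y))) x ≤ C

/-- `E(log w | F_n)`, with values in `[-∞, ∞]`, as the difference of the conditional expectations
of the positive and negative parts of `log w`. For a weight the first one is finite almost surely
(since `log⁺ w ≤ w`), so the difference is never of the form `∞ - ∞` there. -/
noncomputable def condLog (μ : Measure Ω) (ℱ : Filtration ℕ mΩ) (n : ℕ) (w : Ω → ℝ) :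
    Ω → EReal :=
  fun x => ((condE μ ℱ n (fun y => ENNReal.ofReal (Real.log (w y))) x : ℝ≥0∞) : EReal) -
    ((condE μ ℱ n (fun y => ENNReal.ofReal (-Real.log (w y))) x : ℝ≥0∞) : EReal)

/-- `w ∈ A_∞^exp`: `E(w | F_n) ≤ C * exp E(log w | F_n)` for all `n`, with `exp (-∞) = 0`. -/
def MemAExp (μ : Measure Ω) (ℱ : Filtration ℕ mΩ) (w : Ω → ℝ) : Prop :=
  ∃ C : ℝ≥0, ∀ n : ℕ, ∀ᵐ x ∂μ,
    ENNReal.ofReal (mart μ ℱ w n x) ≤ C * EReal.exp (condLog μ ℱ n w x)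

/-- `w ∈ A*_∞`: `E(M*_n w | F_n) ≤ C * w_n` for all `n`. -/
def MemAStar (μ : Measure Ω) (ℱ : Filtration ℕ mΩ) (w : Ω → ℝ) : Prop :=
  ∃ C : ℝ≥0, ∀ n : ℕ, ∀ᵐ x ∂μ,
    condE μ ℱ n (tailedMax μ ℱ n w) x ≤ C * ENNReal.ofReal (mart μ ℱ w n x)

end MartingaleWeights

/-! Everything passes through one condition: `w_n ≤ C E(√w | F_n)²` for all `n`, a reverse Hölder
inequality between the exponents 1/2 and 1. It dominates `M*_n w` by `C sup_{m ≥ n} E(√w | F_m)²`,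
and the conditional Doob inequality in `L²` for `y = √w` bounds the conditional expectation of that
supremum by `4 E(w | F_n) = 4 w_n` (`IsWeight.memAStar_of_le_sq`).

Each hypothesis yields the square-root condition. Under `A_∞^log` or `RH_q`, the part of `w` above a
large multiple `K w_n` carries at most half of the conditional mass, and on the rest `w ≤ √w √(K
w_n)` (`IsWeight.le_sq_of_tail`). Under `A_p` or `A_∞^exp`, one applies Jensen's inequality to `r ^
(-b)` or `log r` with `r = √w / E(√w | F_n)`, which has conditional mean 1; it is proved by
integrating the tangent line at `r = 1`. -/

namespace MartingaleWeights

/-! ### Conditional expectations of `[0, ∞]`-valued functions -/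

section CondLExp

variable {Ω : Type*} {m mΩ : MeasurableSpace Ω} {μ : Measure Ω}

/-- Testing a conditional expectation against a nonnegative measurable function. -/
theorem lintegral_condLExp_mul (hm : m ≤ mΩ) [SigmaFinite (μ.trim hm)] {X g : Ω → ℝ≥0∞}
    (hX : AEMeasurable X μ) (hg : Measurable[m] g) :
    ∫⁻ x, condLExp m μ X x * g x ∂μ = ∫⁻ x, X x * g x ∂μ := by
  have hg' : Measurable g := hg.mono hm le_rfl
  -- The measures with densities `condLExp m μ X` and `X` agree on `m`, which is all that an
  -- `m`-measurable `g` can see.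
  have key : (μ.withDensity (condLExp m μ X)).trim hm = (μ.withDensity X).trim hm := by
    refine @Measure.ext _ m _ _ fun s hs => ?_
    rw [trim_measurableSet_eq hm hs, trim_measurableSet_eq hm hs,
      withDensity_apply _ (hm s hs), withDensity_apply _ (hm s hs),
      setLIntegral_condLExp hm μ X hs]
  have h₁ := lintegral_withDensity_eq_lintegral_mul₀ (μ := μ)
    (measurable_condLExp' m μ X).aemeasurable hg'.aemeasurable
  have h₂ := lintegral_withDensity_eq_lintegral_mul₀ (μ := μ) hX hg'.aemeasurable
  simp only [Pi.mul_apply] at h₁ h₂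
  rw [← h₁, ← h₂, ← lintegral_trim hm hg, key, lintegral_trim hm hg]

theorem setLIntegral_condLExp_mul (hm : m ≤ mΩ) [SigmaFinite (μ.trim hm)] {X g : Ω → ℝ≥0∞}
    (hX : AEMeasurable X μ) (hg : Measurable[m] g) {s : Set Ω} (hs : MeasurableSet[m] s) :
    ∫⁻ x in s, condLExp m μ X x * g x ∂μ = ∫⁻ x in s, X x * g x ∂μ := by
  have h := lintegral_condLExp_mul hm hX (hg.indicator hs)
  simp only [← Set.indicator_mul_right] at h
  rwa [lintegral_indicator (hm s hs), lintegral_indicator (hm s hs)] at h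

/-- The pull-out property. -/
theorem condLExp_mul_of_measurable_right (hm : m ≤ mΩ) [SigmaFinite (μ.trim hm)]
    {X g : Ω → ℝ≥0∞} (hX : AEMeasurable X μ) (hg : Measurable[m] g) :
    condLExp m μ (fun x => X x * g x) =ᵐ[μ] fun x => condLExp m μ X x * g x := by
  refine (ae_eq_condLExp hm μ _ ?_ fun s hs => setLIntegral_condLExp_mul hm hX hg hs).symm
  exact (measurable_condLExp m μ X).mul hg

theorem condLExp_le_of_forall_setLIntegral_le (hm : m ≤ mΩ) [SigmaFinite (μ.trim hm)]
    {X Y : Ω → ℝ≥0∞}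
    (h : ∀ s, MeasurableSet[m] s → ∫⁻ x in s, X x ∂μ ≤ ∫⁻ x in s, Y x ∂μ) :
    condLExp m μ X ≤ᵐ[μ] condLExp m μ Y := by
  refine ae_le_of_ae_le_trim (hm := hm) ?_
  refine ae_le_of_forall_setLIntegral_le_of_sigmaFinite (measurable_condLExp m μ X) ?_
  intro s hs _
  rw [setLIntegral_condLExp_trim hm μ X hs, setLIntegral_condLExp_trim hm μ Y hs]
  exact h s hs

/-- The set where the conditional expectation vanishes lies in `m`, so `X` has integral zero over
it; as `X > 0`, it is null. -/
theorem condLExp_pos (hm : m ≤ mΩ) [SigmaFinite (μ.trim hm)] {X : Ω → ℝ≥0∞}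
    (hX : AEMeasurable X μ) (hpos : ∀ᵐ x ∂μ, 0 < X x) : ∀ᵐ x ∂μ, 0 < condLExp m μ X x := by
  have hs : MeasurableSet[m] {x | condLExp m μ X x = 0} :=
    measurable_condLExp m μ X (measurableSet_singleton 0)
  have h := setLIntegral_condLExp hm μ X hs
  rw [setLIntegral_congr_fun (g := fun _ => 0) (hm _ hs) (fun x hx => hx), lintegral_zero,
    eq_comm, lintegral_eq_zero_iff' hX.restrict, Filter.EventuallyEq,
    ae_restrict_iff' (hm _ hs)] at h
  filter_upwards [h, hpos] with x hx hx'
  refine pos_iff_ne_zero.2 fun h0 => hx'.ne' (hx h0)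

end CondLExp

/-! ### The conditional Doob inequality in `L²` -/

section Doob

variable {Ω : Type*} {mΩ : MeasurableSpace Ω} {μ : Measure Ω} [IsFiniteMeasure μ]
  (ℱ : Filtration ℕ mΩ)

/-- One step of the running maximum: with increment `d = g - s`, `(s + d)² ≤ s² + 2 (s + d) d`, and
the new maximum `s + d = g` is at most `f` whenever `d > 0`. -/
theorem sq_max_le {s f g : ℝ≥0∞} (hgf : g ≤ f) :
    max s g ^ 2 ≤ s ^ 2 + 2 * (f * (max s g - s)) := by
  rcases le_total g s with h | h
  · simp [h]
  · obtain ⟨d, rfl⟩ := exists_add_of_le h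
    rw [max_eq_right h]
    rcases eq_or_ne s ∞ with rfl | hs
    · simp
    · rw [ENNReal.add_sub_cancel_left hs]
      calc (s + d) ^ 2 ≤ (s + d) ^ 2 + d ^ 2 := le_self_add
        _ = s ^ 2 + 2 * ((s + d) * d) := by ring
        _ ≤ _ := by gcongr

theorem measurable_partialSups_apply {f : ℕ → Ω → ℝ≥0∞} {n : ℕ}
    (hf : ∀ i, Measurable[ℱ (n + i)] (f i)) (j : ℕ) :
    Measurable[ℱ (n + j)] (fun x => partialSups (fun i => f i x) j) := by
  induction j with
  | zero => simpa using hf 0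
  | succ j ih =>
    simp only [partialSups_add_one]
    exact (ih.mono (ℱ.mono (by omega)) le_rfl).sup (hf (j + 1))

/-- Doob's inequality for the truncated maximal function, before absorption. -/
theorem setLIntegral_sq_partialSups_le {y : Ω → ℝ≥0∞} (hy : AEMeasurable y μ) {n : ℕ}
    (c : ℝ≥0∞) {s : Set Ω} (hs : MeasurableSet[ℱ n] s) (j : ℕ) :
    ∫⁻ x in s, partialSups (fun i => min (condLExp (ℱ (n + i)) μ y x) c) j ^ 2 ∂μ ≤
      2 * ∫⁻ x in s, y x * partialSups (fun i => min (condLExp (ℱ (n + i)) μ y x) c) j ∂μ := by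
  set S : ℕ → Ω → ℝ≥0∞ :=
    fun j x => partialSups (fun i => min (condLExp (ℱ (n + i)) μ y x) c) j with hS
  have hSm : ∀ j, Measurable[ℱ (n + j)] (S j) := measurable_partialSups_apply ℱ
    fun i => (measurable_condLExp (ℱ (n + i)) μ y).min measurable_const
  have hSm' : ∀ j, Measurable (S j) := fun j => (hSm j).mono (ℱ.le _) le_rfl
  have hsucc : ∀ j x, S (j + 1) x = max (S j x) (min (condLExp (ℱ (n + (j + 1))) μ y x) c) :=
    fun j x => partialSups_add_one _ _
  change ∫⁻ x in s, S j x ^ 2 ∂μ ≤ 2 * ∫⁻ x in s, y x * S j x ∂μ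
  induction j with
  | zero =>
    have h0 : ∀ x, S 0 x = min (condLExp (ℱ n) μ y x) c := fun x => by simp [hS]
    calc ∫⁻ x in s, S 0 x ^ 2 ∂μ ≤ ∫⁻ x in s, condLExp (ℱ n) μ y x * S 0 x ∂μ := by
          refine lintegral_mono fun x => ?_
          rw [sq]
          gcongr
          rw [h0]
          exact min_le_left _ _
      _ = ∫⁻ x in s, y x * S 0 x ∂μ := setLIntegral_condLExp_mul (ℱ.le n) hy (hSm 0) hs
      _ ≤ _ := by rw [two_mul]; exact le_self_add
  | succ j ih =>
    have hle : ∀ x, S j x ≤ S (j + 1) x := fun x => by rw [hsucc]; exact le_max_left _ _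
    -- The increment is measurable at the time of the new conditional expectation, so the latter may
    -- be replaced by `y`; the terms `y * increment` then telescope.
    have hd : Measurable[ℱ (n + (j + 1))] (fun x => S (j + 1) x - S j x) :=
      (hSm (j + 1)).sub ((hSm j).mono (ℱ.mono (by omega)) le_rfl)
    have hs' : MeasurableSet[ℱ (n + (j + 1))] s := ℱ.mono (by omega) s hs
    calc ∫⁻ x in s, S (j + 1) x ^ 2 ∂μ
        ≤ ∫⁻ x in s, (S j x ^ 2 +
            2 * (condLExp (ℱ (n + (j + 1))) μ y x * (S (j + 1) x - S j x))) ∂μ := by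
          refine lintegral_mono fun x => ?_
          simp only [hsucc]
          exact sq_max_le (min_le_left _ _)
      _ = ∫⁻ x in s, S j x ^ 2 ∂μ + 2 * ∫⁻ x in s, y x * (S (j + 1) x - S j x) ∂μ := by
          rw [lintegral_add_left ((hSm' j).pow_const 2), lintegral_const_mul' _ _ (by simp),
            setLIntegral_condLExp_mul (ℱ.le _) hy hd hs']
      _ ≤ 2 * ∫⁻ x in s, y x * S j x ∂μ + 2 * ∫⁻ x in s, y x * (S (j + 1) x - S j x) ∂μ := by
          gcongr
      _ = 2 * ∫⁻ x in s, y x * S (j + 1) x ∂μ := by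
          rw [← mul_add, ← lintegral_add_left' (f := fun x => y x * S j x)
            (hy.restrict.mul (hSm' j).aemeasurable)]
          simp only [← mul_add, add_tsub_cancel_of_le (hle _)]

theorem two_mul_mul_le_sq_add_sq (a b : ℝ≥0∞) : 2 * (2 * (a * b)) ≤ 4 * a ^ 2 + b ^ 2 := by
  rcases eq_or_ne a ∞ with rfl | ha
  · simp [ENNReal.mul_top]
  rcases eq_or_ne b ∞ with rfl | hb
  · simp
  lift a to ℝ≥0 using ha
  lift b to ℝ≥0 using hb
  norm_cast
  rw [← NNReal.coe_le_coe]
  push_cast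
  nlinarith [sq_nonneg (2 * (a : ℝ) - b)]

theorem le_of_two_mul_le_add {a b : ℝ≥0∞} (ha : a ≠ ∞) (h : 2 * a ≤ b + a) : a ≤ b := by
  rw [two_mul] at h
  exact (ENNReal.add_le_add_iff_right ha).1 h

/-- Absorption: `4 y S ≤ 4 y² + S²`, and truncation at `c` makes `∫ S²` finite, so that it can be
cancelled. -/
theorem setLIntegral_sq_partialSups_le_sq {y : Ω → ℝ≥0∞} (hy : AEMeasurable y μ) {n : ℕ}
    (c : ℝ≥0) {s : Set Ω} (hs : MeasurableSet[ℱ n] s) (j : ℕ) :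
    ∫⁻ x in s, partialSups (fun i => min (condLExp (ℱ (n + i)) μ y x) c) j ^ 2 ∂μ ≤
      4 * ∫⁻ x in s, y x ^ 2 ∂μ := by
  have h := setLIntegral_sq_partialSups_le ℱ hy c hs j
  set S : Ω → ℝ≥0∞ := fun x => partialSups (fun i => min (condLExp (ℱ (n + i)) μ y x) c) j with hS
  change ∫⁻ x in s, S x ^ 2 ∂μ ≤ 2 * ∫⁻ x in s, y x * S x ∂μ at h
  change ∫⁻ x in s, S x ^ 2 ∂μ ≤ _
  refine le_of_two_mul_le_add ?_ ?_
  · refine ne_of_lt ?_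
    calc ∫⁻ x in s, S x ^ 2 ∂μ ≤ ∫⁻ _ in s, (c : ℝ≥0∞) ^ 2 ∂μ := by
          refine lintegral_mono fun x => ?_
          gcongr
          exact partialSups_le _ _ _ fun i _ => min_le_right _ _
      _ < ∞ := by
          rw [lintegral_const]
          exact ENNReal.mul_lt_top (by simp) (measure_lt_top _ _)
  · calc 2 * ∫⁻ x in s, S x ^ 2 ∂μ ≤ 2 * (2 * ∫⁻ x in s, y x * S x ∂μ) := by gcongr
      _ = ∫⁻ x in s, 2 * (2 * (y x * S x)) ∂μ := by
          rw [lintegral_const_mul' _ _ (by simp), lintegral_const_mul' _ _ (by simp)]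
      _ ≤ ∫⁻ x in s, (4 * y x ^ 2 + S x ^ 2) ∂μ :=
          lintegral_mono fun x => two_mul_mul_le_sq_add_sq _ _
      _ = _ := by
          rw [lintegral_add_left' ((hy.restrict.pow_const 2).const_mul 4),
            lintegral_const_mul' _ _ (by simp)]

theorem iSup_pow_two {ι : Type*} (f : ι → ℝ≥0∞) : (⨆ i, f i) ^ 2 = ⨆ i, f i ^ 2 := by
  have h := (ENNReal.orderIsoRpow 2 two_pos).map_iSup f
  simp only [ENNReal.orderIsoRpow_apply] at h
  exact_mod_cast h

/-- Removes the truncation level and the finite horizon, so that two monotone limits give the full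
inequality. -/
theorem iSup_iSup_partialSups_min (f : ℕ → ℝ≥0∞) :
    ⨆ (k : ℕ) (j : ℕ), partialSups (fun i => min (f i) ((k : ℝ≥0) : ℝ≥0∞)) j = ⨆ i, f i := by
  simp only [iSup_partialSups_eq]
  rw [iSup_comm]
  refine iSup_congr fun i => ?_
  simp only [ENNReal.coe_natCast]
  rw [← inf_iSup_eq, ENNReal.iSup_natCast, inf_top_eq]

/-- **Conditional Doob `L²` inequality**, integrated over a set of the `σ`-algebra `ℱ n`. -/
theorem setLIntegral_sq_iSup_condLExp_le {y : Ω → ℝ≥0∞} (hy : AEMeasurable y μ) {n : ℕ}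
    {s : Set Ω} (hs : MeasurableSet[ℱ n] s) :
    ∫⁻ x in s, (⨆ i, condLExp (ℱ (n + i)) μ y x) ^ 2 ∂μ ≤ 4 * ∫⁻ x in s, y x ^ 2 ∂μ := by
  set S : ℕ → ℕ → Ω → ℝ≥0∞ := fun k j x =>
    partialSups (fun i => min (condLExp (ℱ (n + i)) μ y x) ((k : ℝ≥0) : ℝ≥0∞)) j with hS
  have hSm : ∀ k j, Measurable (S k j) := fun k j =>
    (measurable_partialSups_apply ℱ
      (fun i => (measurable_condLExp (ℱ (n + i)) μ y).min measurable_const) j).mono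
      (ℱ.le _) le_rfl
  have hmono : ∀ k, Monotone fun j x => S k j x ^ 2 := fun k a b hab x => by
    have := (partialSups fun i => min (condLExp (ℱ (n + i)) μ y x) ((k : ℝ≥0) : ℝ≥0∞)).mono hab
    change _ ^ 2 ≤ _ ^ 2
    gcongr
  have hmono' : Monotone fun k x => ⨆ j, S k j x ^ 2 := fun a b hab x => by
    refine iSup_mono fun j => ?_
    have : S a j x ≤ S b j x := partialSups_mono (fun i => by gcongr) j
    gcongr
  have hsup : ∀ x, (⨆ i, condLExp (ℱ (n + i)) μ y x) ^ 2 = ⨆ k, ⨆ j, S k j x ^ 2 := fun x => by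
    rw [← iSup_iSup_partialSups_min]
    simp only [iSup_pow_two, hS]
  simp only [hsup]
  rw [lintegral_iSup (fun k => .iSup fun j => (hSm k j).pow_const 2) hmono']
  refine iSup_le fun k => ?_
  rw [lintegral_iSup (fun j => (hSm k j).pow_const 2) (hmono k)]
  exact iSup_le fun j => setLIntegral_sq_partialSups_le_sq ℱ hy k hs j

theorem condLExp_sq_iSup_condLExp_le {y : Ω → ℝ≥0∞} (hy : AEMeasurable y μ) (n : ℕ) :
    condLExp (ℱ n) μ (fun x => (⨆ i, condLExp (ℱ (n + i)) μ y x) ^ 2) ≤ᵐ[μ]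
      condLExp (ℱ n) μ (fun x => 4 * y x ^ 2) := by
  refine condLExp_le_of_forall_setLIntegral_le (ℱ.le n) fun s hs => ?_
  rw [lintegral_const_mul' _ _ (by simp)]
  exact setLIntegral_sq_iSup_condLExp_le ℱ hy hs

end Doob

/-! ### From the square-root condition to `A*_∞` -/

section Weight

variable {Ω : Type*} {mΩ : MeasurableSpace Ω} {μ : Measure Ω}
  {ℱ : Filtration ℕ mΩ} {w : Ω → ℝ}

theorem IsWeight.ofReal_mart_ae_eq (hw : IsWeight μ w) (n : ℕ) :
    (fun x => ENNReal.ofReal (mart μ ℱ w n x)) =ᵐ[μ]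
      condLExp (ℱ n) μ fun x => ENNReal.ofReal (w x) :=
  (condLExp_ofReal (ℱ n) hw.integrable (hw.pos.mono fun _ h => h.le)).symm

theorem IsWeight.aemeasurable_ofReal (hw : IsWeight μ w) :
    AEMeasurable (fun x => ENNReal.ofReal (w x)) μ :=
  hw.integrable.aestronglyMeasurable.aemeasurable.ennreal_ofReal

/-- The square root of a weight, as a `[0, ∞]`-valued function. -/
noncomputable def sqrtWeight (w : Ω → ℝ) (x : Ω) : ℝ≥0∞ := ENNReal.ofReal (√(w x))

theorem sqrtWeight_sq {x : Ω} (h : 0 ≤ w x) : sqrtWeight w x ^ 2 = ENNReal.ofReal (w x) := by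
  rw [sqrtWeight, ← ENNReal.ofReal_pow (Real.sqrt_nonneg _), Real.sq_sqrt h]

theorem IsWeight.aemeasurable_sqrtWeight (hw : IsWeight μ w) : AEMeasurable (sqrtWeight w) μ :=
  hw.integrable.aestronglyMeasurable.aemeasurable.sqrt.ennreal_ofReal

variable [IsFiniteMeasure μ]

theorem IsWeight.mart_pos (hw : IsWeight μ w) (n : ℕ) : ∀ᵐ x ∂μ, 0 < mart μ ℱ w n x := by
  filter_upwards [hw.ofReal_mart_ae_eq (ℱ := ℱ) n, condLExp_pos (ℱ.le n) hw.aemeasurable_ofReal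
    (hw.pos.mono fun _ h => ENNReal.ofReal_pos.2 h)] with x h1 h2
  rw [← h1] at h2
  exact ENNReal.ofReal_pos.1 h2

theorem IsWeight.condLExp_sqrtWeight_pos (hw : IsWeight μ w) (n : ℕ) :
    ∀ᵐ x ∂μ, 0 < condLExp (ℱ n) μ (sqrtWeight w) x :=
  condLExp_pos (ℱ.le n) hw.aemeasurable_sqrtWeight
    (hw.pos.mono fun _ h => ENNReal.ofReal_pos.2 (Real.sqrt_pos.2 h))

theorem IsWeight.condLExp_sqrtWeight_ne_top (hw : IsWeight μ w) (n : ℕ) :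
    ∀ᵐ x ∂μ, condLExp (ℱ n) μ (sqrtWeight w) x ≠ ∞ := by
  refine condLExp_ne_top (ne_of_lt ?_)
  calc ∫⁻ x, sqrtWeight w x ∂μ ≤ ∫⁻ x, (1 + ENNReal.ofReal (w x)) ∂μ := by
        refine lintegral_mono_ae (hw.pos.mono fun x hx => ?_)
        rw [sqrtWeight, ← ENNReal.ofReal_one, ← ENNReal.ofReal_add zero_le_one hx.le]
        refine ENNReal.ofReal_le_ofReal ?_
        nlinarith [Real.sq_sqrt hx.le, Real.sqrt_nonneg (w x), sq_nonneg (√(w x) - 1)]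
    _ < ∞ := by
        rw [lintegral_add_left measurable_const, lintegral_const]
        exact ENNReal.add_lt_top.2 ⟨ENNReal.mul_lt_top (by simp) (measure_lt_top _ _),
          hw.integrable.lintegral_lt_top⟩

/-- A reverse Hölder inequality between the exponents `1/2` and `1` implies `w ∈ A*_∞`. -/
theorem IsWeight.memAStar_of_le_sq (hw : IsWeight μ w) (C : ℝ≥0)
    (h : ∀ n, ∀ᵐ x ∂μ, ENNReal.ofReal (mart μ ℱ w n x) ≤
      C * condLExp (ℱ n) μ (sqrtWeight w) x ^ 2) : MemAStar μ ℱ w := by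
  -- The factor 4 is Doob's constant in `L²`.
  refine ⟨C * 4, fun n => ?_⟩
  have hmax : tailedMax μ ℱ n w ≤ᵐ[μ]
      (C : ℝ≥0∞) • fun x => (⨆ i, condLExp (ℱ (n + i)) μ (sqrtWeight w) x) ^ 2 := by
    filter_upwards [ae_all_iff.2 h, ae_all_iff.2 fun m => hw.mart_pos (ℱ := ℱ) m] with x hx hpos
    refine iSup₂_le fun m hm => ?_
    rw [abs_of_pos (hpos m)]
    obtain ⟨i, rfl⟩ := exists_add_of_le hm
    refine (hx _).trans ?_
    simp only [Pi.smul_apply, smul_eq_mul]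
    gcongr
    exact le_iSup (fun i => condLExp (ℱ (n + i)) μ (sqrtWeight w) x) i
  have hsq : condLExp (ℱ n) μ (fun x => 4 * sqrtWeight w x ^ 2) =ᵐ[μ]
      condLExp (ℱ n) μ ((4 : ℝ≥0∞) • fun x => ENNReal.ofReal (w x)) :=
    condLExp_congr_ae (hw.pos.mono fun x hx => by simp [sqrtWeight_sq hx.le])
  filter_upwards [condLExp_mono (mΩ := ℱ n) hmax,
    condLExp_smul' (mΩ := ℱ n) (P := μ)
      (fun x => (⨆ i, condLExp (ℱ (n + i)) μ (sqrtWeight w) x) ^ 2) (c := C) (by simp),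
    condLExp_sq_iSup_condLExp_le ℱ hw.aemeasurable_sqrtWeight n, hsq,
    condLExp_smul' (mΩ := ℱ n) (P := μ) (fun x => ENNReal.ofReal (w x)) (c := 4) (by simp),
    hw.ofReal_mart_ae_eq (ℱ := ℱ) n] with x h1 h2 h3 h4 h5 h6
  rw [h2, Pi.smul_apply, smul_eq_mul] at h1
  rw [h4, h5, Pi.smul_apply, smul_eq_mul, ← h6] at h3
  calc condE μ ℱ n (tailedMax μ ℱ n w) x ≤ _ := h1
    _ ≤ C * (4 * ENNReal.ofReal (mart μ ℱ w n x)) := by gcongr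
    _ = _ := by push_cast; ring

end Weight

/-! ### The four hypotheses imply the square-root condition -/

section SquareRootCondition

variable {Ω : Type*} {mΩ : MeasurableSpace Ω} {μ : Measure Ω}
  {ℱ : Filtration ℕ mΩ} {w : Ω → ℝ}

theorem measurable_mart (n : ℕ) : Measurable[ℱ n] (mart μ ℱ w n) :=
  stronglyMeasurable_condExp.measurable

/-- The conditional expectation of `√w`, as a real-valued function. -/
noncomputable def condSqrt (μ : Measure Ω) (ℱ : Filtration ℕ mΩ) (w : Ω → ℝ) (n : ℕ) (x : Ω) : ℝ :=
  (condLExp (ℱ n) μ (sqrtWeight w) x).toReal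

theorem measurable_condSqrt (n : ℕ) : Measurable[ℱ n] (condSqrt μ ℱ w n) :=
  (measurable_condLExp (ℱ n) μ (sqrtWeight w)).ennreal_toReal

variable [IsFiniteMeasure μ]

/-- If the part `Z` of `w` above a multiple of `w_n` carries at most half of the conditional mass,
then `w_n` is controlled by the conditional expectation of `√w`. -/
theorem IsWeight.le_sq_of_tail (hw : IsWeight μ w) {n : ℕ} {K : ℝ} (hK : 0 ≤ K) {Z : Ω → ℝ≥0∞}
    (h : ∀ᵐ x ∂μ, K * mart μ ℱ w n x < w x → ENNReal.ofReal (w x) ≤ Z x)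
    (hZ : ∀ᵐ x ∂μ, condLExp (ℱ n) μ Z x ≤ ENNReal.ofReal (mart μ ℱ w n x / 2)) :
    ∀ᵐ x ∂μ, ENNReal.ofReal (mart μ ℱ w n x) ≤
      ENNReal.ofReal (4 * K) * condLExp (ℱ n) μ (sqrtWeight w) x ^ 2 := by
  -- Off the tail `w = √w √w ≤ √w g`, and `g` is `ℱ n`-measurable, so it pulls out of the
  -- conditional expectation.
  set g : Ω → ℝ≥0∞ := fun x => ENNReal.ofReal (√(K * mart μ ℱ w n x))
  have hg : Measurable[ℱ n] g := ((measurable_mart n).const_mul K).sqrt.ennreal_ofReal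
  have hle : (fun x => ENNReal.ofReal (w x)) ≤ᵐ[μ] Z + fun x => sqrtWeight w x * g x := by
    filter_upwards [h, hw.pos] with x hx hpos
    by_cases hlt : K * mart μ ℱ w n x < w x
    · exact (hx hlt).trans le_self_add
    · refine le_trans ?_ le_add_self
      rw [← sqrtWeight_sq hpos.le, sq]
      simp only [g, sqrtWeight]
      gcongr
      exact not_lt.1 hlt
  filter_upwards [condLExp_mono (mΩ := ℱ n) hle,
    condLExp_add_right (mΩ := ℱ n) Z (Y := fun x => sqrtWeight w x * g x)
      (hw.aemeasurable_sqrtWeight.mul (hg.mono (ℱ.le n) le_rfl).aemeasurable),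
    condLExp_mul_of_measurable_right (ℱ.le n) hw.aemeasurable_sqrtWeight hg, hZ,
    hw.ofReal_mart_ae_eq (ℱ := ℱ) n, hw.mart_pos (ℱ := ℱ) n,
    hw.condLExp_sqrtWeight_ne_top (ℱ := ℱ) n] with x h1 h2 h3 h4 h5 h6 h7
  rw [h2, Pi.add_apply, h3, ← h5] at h1
  set v := mart μ ℱ w n x
  obtain ⟨t, ht⟩ : ∃ t : ℝ≥0, condLExp (ℱ n) μ (sqrtWeight w) x = t :=
    ⟨_, (ENNReal.coe_toNNReal h7).symm⟩
  rw [ht] at h1 ⊢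
  have h8 : ENNReal.ofReal v ≤ ENNReal.ofReal (v / 2 + t * √(K * v)) := by
    rw [ENNReal.ofReal_add (by positivity) (by positivity), ENNReal.ofReal_mul (by positivity),
      ENNReal.ofReal_coe_nnreal]
    exact h1.trans (by gcongr)
  rw [ENNReal.ofReal_le_ofReal_iff (by positivity), Real.sqrt_mul hK] at h8
  rw [← ENNReal.ofReal_coe_nnreal, ← ENNReal.ofReal_pow t.coe_nonneg, ← ENNReal.ofReal_mul (by positivity)]
  refine ENNReal.ofReal_le_ofReal ?_
  have hu := Real.sqrt_pos.2 h6
  have hu2 := Real.sq_sqrt h6.le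
  have hk2 := Real.sq_sqrt hK
  have hk := Real.sqrt_nonneg K
  have ht0 : (0 : ℝ) ≤ t := t.2
  -- With `t = E(√w | F_n)`, cancel `√v` in `v / 2 ≤ t √K √v`; squaring then produces the constant
  -- `4 K`.
  have h9 : √v ≤ 2 * (t * √K) := by
    refine le_of_mul_le_mul_right ?_ hu
    nlinarith
  calc v = √v ^ 2 := hu2.symm
    _ ≤ (2 * (t * √K)) ^ 2 := by gcongr
    _ = 4 * K * (t : ℝ) ^ 2 := by rw [mul_pow, mul_pow, hk2]; ring

/-- On the tail `w > e^(2C+1) w_n` the logarithm is at least `2C + 1`, so `Z = c w log⁺(w / w_n)`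
dominates `w` there. Its conditional mass is at most `c C w_n ≤ w_n / 2`. -/
theorem IsWeight.memAStar_of_memALog (hw : IsWeight μ w) (h : MemALog μ ℱ w) :
    MemAStar μ ℱ w := by
  obtain ⟨C, hC⟩ := h
  set c : ℝ := 1 / (2 * C + 1) with hc
  have hc0 : 0 < c := by positivity
  refine hw.memAStar_of_le_sq (Real.toNNReal (4 * Real.exp (2 * C + 1))) fun n => ?_
  set U : Ω → ℝ≥0∞ := fun x => ENNReal.ofReal (w x) *
    ENNReal.ofReal (Real.posLog (w x / mart μ ℱ w n x)) with hU
  have hmart : Measurable (mart μ ℱ w n) := (measurable_mart n).mono (ℱ.le n) le_rfl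
  have hwm : AEMeasurable w μ := hw.integrable.aestronglyMeasurable.aemeasurable
  have hL : AEMeasurable
      (fun x => ENNReal.ofReal (Real.posLog (w x / mart μ ℱ w n x))) μ := by
    have : AEMeasurable (fun x => Real.log (w x / mart μ ℱ w n x)) μ :=
      (hwm.div hmart.aemeasurable).log
    exact (aemeasurable_const.sup this).ennreal_ofReal
  have : IsFiniteMeasure (weighted μ w) :=
    isFiniteMeasure_withDensity_ofReal hw.integrable.2
  -- The weighted hypothesis becomes an unweighted one after integration over sets of `ℱ n`: `E(w
  -- log⁺(w / w_n) | F_n) ≤ C w_n`.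
  have hUC : condLExp (ℱ n) μ U ≤ᵐ[μ]
      condLExp (ℱ n) μ ((C : ℝ≥0∞) • fun x => ENNReal.ofReal (w x)) := by
    refine condLExp_le_of_forall_setLIntegral_le (ℱ.le n) fun s hs => ?_
    have hs' := ℱ.le n s hs
    have hswap := setLIntegral_withDensity_eq_lintegral_mul₀ hw.aemeasurable_ofReal hL hs'
    simp only [Pi.mul_apply] at hswap
    calc ∫⁻ x in s, U x ∂μ
        = ∫⁻ x in s, ENNReal.ofReal (Real.posLog (w x / mart μ ℱ w n x)) ∂(weighted μ w) :=
          hswap.symm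
      _ = ∫⁻ x in s, condE (weighted μ w) ℱ n
            (fun y => ENNReal.ofReal (Real.posLog (w y / mart μ ℱ w n y))) x ∂(weighted μ w) :=
          (setLIntegral_condLExp (ℱ.le n) _ _ hs).symm
      _ ≤ ∫⁻ _ in s, (C : ℝ≥0∞) ∂(weighted μ w) :=
          lintegral_mono_ae (ae_restrict_of_ae
            ((withDensity_absolutelyContinuous μ _).ae_le (hC n)))
      _ = ∫⁻ x in s, ((C : ℝ≥0∞) • fun x => ENNReal.ofReal (w x)) x ∂μ := by
          simp only [Pi.smul_apply, smul_eq_mul]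
          rw [setLIntegral_const, weighted, withDensity_apply _ hs',
            lintegral_const_mul' _ _ (by simp)]
  refine hw.le_sq_of_tail (Z := ENNReal.ofReal c • U) (Real.exp_pos _).le ?_ ?_
  · filter_upwards [hw.pos, hw.mart_pos (ℱ := ℱ) n] with x hx hm hlt
    simp only [Pi.smul_apply, smul_eq_mul, hU]
    rw [← ENNReal.ofReal_mul hx.le, ← ENNReal.ofReal_mul hc0.le]
    refine ENNReal.ofReal_le_ofReal ?_
    have h1 : 2 * C + 1 ≤ Real.posLog (w x / mart μ ℱ w n x) := by
      refine le_trans ?_ (le_max_right _ _)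
      rw [Real.le_log_iff_exp_le (by positivity), le_div_iff₀ hm]
      exact hlt.le
    calc w x = c * (w x * (2 * C + 1)) := by rw [hc]; field_simp
      _ ≤ _ := by gcongr
  · filter_upwards [hUC, condLExp_smul' (mΩ := ℱ n) (P := μ) U (c := ENNReal.ofReal c) (by simp),
      condLExp_smul' (mΩ := ℱ n) (P := μ) (fun x => ENNReal.ofReal (w x)) (c := C) (by simp),
      hw.ofReal_mart_ae_eq (ℱ := ℱ) n, hw.mart_pos (ℱ := ℱ) n] with x h1 h2 h3 h4 h5
    rw [h3, Pi.smul_apply, ← h4, smul_eq_mul] at h1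
    rw [h2, Pi.smul_apply, smul_eq_mul]
    calc _ ≤ ENNReal.ofReal c * (C * ENNReal.ofReal (mart μ ℱ w n x)) := by gcongr
      _ = ENNReal.ofReal (c * (C * mart μ ℱ w n x)) := by
          rw [ENNReal.ofReal_mul hc0.le, ENNReal.ofReal_mul C.coe_nonneg, ENNReal.ofReal_coe_nnreal]
      _ ≤ _ := by
          refine ENNReal.ofReal_le_ofReal ?_
          have hC0 : (0 : ℝ) ≤ C := C.2
          rw [hc, one_div, inv_mul_le_iff₀ (by positivity)]
          nlinarith

/-- On the tail `w > K w_n`, `w = w^q w^(1-q) ≤ w^q (K w_n)^(1-q)` since `1 - q < 0`. The right side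
has conditional mass at most `C K^(1-q) w_n`. -/
theorem IsWeight.memAStar_of_memRH (hw : IsWeight μ w) {q : ℝ} (hq : 1 < q)
    (h : MemRH μ ℱ q w) : MemAStar μ ℱ w := by
  obtain ⟨C, hC⟩ := h
  have hD : (0 : ℝ) < 2 * C + 1 := by positivity
  -- Chosen so that `K^(1-q) = 1 / (2C + 1)`, hence `C K^(1-q) ≤ 1/2`.
  set K : ℝ := (2 * (C : ℝ) + 1) ^ (1 / (q - 1)) with hK
  have hK0 : 0 < K := by positivity
  have hKq : K ^ (1 - q) = (2 * (C : ℝ) + 1)⁻¹ := by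
    rw [hK, ← Real.rpow_mul hD.le, ← Real.rpow_neg_one]
    congr 1
    have : q - 1 ≠ 0 := by linarith
    field_simp
    ring
  refine hw.memAStar_of_le_sq (Real.toNNReal (4 * K)) fun n => ?_
  set g : Ω → ℝ≥0∞ := fun x => ENNReal.ofReal ((K * mart μ ℱ w n x) ^ (1 - q)) with hg
  have hgm : Measurable[ℱ n] g :=
    (((measurable_mart n).const_mul K).pow_const (1 - q)).ennreal_ofReal
  have hWq : AEMeasurable (fun x => ENNReal.ofReal (w x) ^ q) μ :=
    hw.aemeasurable_ofReal.pow_const q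
  refine hw.le_sq_of_tail (Z := fun x => ENNReal.ofReal (w x) ^ q * g x) hK0.le ?_ ?_
  · filter_upwards [hw.pos, hw.mart_pos (ℱ := ℱ) n] with x hx hm hlt
    simp only [hg]
    rw [ENNReal.ofReal_rpow_of_pos hx, ← ENNReal.ofReal_mul (by positivity)]
    refine ENNReal.ofReal_le_ofReal ?_
    calc w x = w x ^ q * w x ^ (1 - q) := by rw [← Real.rpow_add hx]; simp
      _ ≤ _ := mul_le_mul_of_nonneg_left
        (Real.rpow_le_rpow_of_nonpos (by positivity) hlt.le (by linarith)) (by positivity)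
  · filter_upwards [hC n, condLExp_mul_of_measurable_right (ℱ.le n) hWq hgm,
      hw.mart_pos (ℱ := ℱ) n] with x h1 h2 hm
    rw [h2]
    calc _ ≤ C * ENNReal.ofReal (mart μ ℱ w n x) ^ q * g x := by gcongr; exact h1
      _ = ENNReal.ofReal (C * mart μ ℱ w n x ^ q * (K * mart μ ℱ w n x) ^ (1 - q)) := by
          rw [ENNReal.ofReal_mul (by positivity), ENNReal.ofReal_mul C.coe_nonneg,
            ENNReal.ofReal_coe_nnreal, ENNReal.ofReal_rpow_of_pos hm]
      _ ≤ _ := by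
          refine ENNReal.ofReal_le_ofReal ?_
          have hC0 : (0 : ℝ) ≤ C := C.2
          have hmm : mart μ ℱ w n x ^ q * mart μ ℱ w n x ^ (1 - q) = mart μ ℱ w n x := by
            rw [← Real.rpow_add hm]; simp
          rw [Real.mul_rpow hK0.le hm.le, hKq]
          calc C * mart μ ℱ w n x ^ q * ((2 * (C : ℝ) + 1)⁻¹ * mart μ ℱ w n x ^ (1 - q))
              = (2 * (C : ℝ) + 1)⁻¹ *
                  (C * (mart μ ℱ w n x ^ q * mart μ ℱ w n x ^ (1 - q))) := by ring
            _ ≤ _ := by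
              rw [hmm, inv_mul_le_iff₀ hD]
              nlinarith

theorem IsWeight.condSqrt_pos (hw : IsWeight μ w) (n : ℕ) : ∀ᵐ x ∂μ, 0 < condSqrt μ ℱ w n x := by
  filter_upwards [hw.condLExp_sqrtWeight_pos (ℱ := ℱ) n,
    hw.condLExp_sqrtWeight_ne_top (ℱ := ℱ) n] with x h1 h2
  exact ENNReal.toReal_pos h1.ne' h2

theorem IsWeight.ofReal_condSqrt (hw : IsWeight μ w) (n : ℕ) : ∀ᵐ x ∂μ,
    ENNReal.ofReal (condSqrt μ ℱ w n x) = condLExp (ℱ n) μ (sqrtWeight w) x :=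
  (hw.condLExp_sqrtWeight_ne_top n).mono fun _ h => ENNReal.ofReal_toReal h

/-- Evaluates the linear term `b r` of the tangent-line inequalities, since `r = √w / E(√w | F_n)`
has conditional mean 1. -/
theorem IsWeight.condLExp_sqrtWeight_mul_inv (hw : IsWeight μ w) (n : ℕ) {b : ℝ} :
    condLExp (ℱ n) μ (fun x => sqrtWeight w x * ENNReal.ofReal (b / condSqrt μ ℱ w n x)) =ᵐ[μ]
      fun _ => ENNReal.ofReal b := by
  filter_upwards [condLExp_mul_of_measurable_right (ℱ.le n) hw.aemeasurable_sqrtWeight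
    (g := fun x => ENNReal.ofReal (b / condSqrt μ ℱ w n x))
    ((measurable_condSqrt n).const_div b).ennreal_ofReal,
    hw.condSqrt_pos (ℱ := ℱ) n, hw.ofReal_condSqrt (ℱ := ℱ) n] with x h1 h2 h3
  rw [h1, ← h3, ← ENNReal.ofReal_mul h2.le, mul_div_cancel₀ _ h2.ne']

/-- Tangent line of `r ^ (-b)` at `r = 1`: `r ^ (-b) = e^(-b log r) ≥ 1 - b log r ≥ 1 - b (r - 1)`.
-/
theorem one_add_le_rpow_neg_add {r b : ℝ} (hr : 0 < r) (hb : 0 ≤ b) :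
    1 + b ≤ r ^ (-b) + b * r := by
  have h1 := Real.log_le_sub_one_of_pos hr
  have h2 := Real.add_one_le_exp (Real.log r * -b)
  rw [Real.rpow_def_of_pos hr]
  nlinarith

/-- With `t = E(√w | F_n)` and `a = 1 / (p - 1)`, Jensen's inequality for `(√w / t) ^ (-2a) = w ^
(-a) t ^ (2a)` gives `1 ≤ E(w ^ (-a) | F_n) t ^ (2a)`. Its power `p - 1`, multiplied by `w_n`, meets
the `A_p` bound. -/
theorem IsWeight.memAStar_of_memAp (hw : IsWeight μ w) {p : ℝ} (hp : 1 < p)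
    (h : MemAp μ ℱ p w) : MemAStar μ ℱ w := by
  obtain ⟨C, hC⟩ := h
  refine hw.memAStar_of_le_sq C fun n => ?_
  have hp' : 0 < p - 1 := by linarith
  set a : ℝ := 1 / (p - 1) with ha
  have ha0 : 0 < a := by positivity
  set g : Ω → ℝ≥0∞ := fun x => ENNReal.ofReal (condSqrt μ ℱ w n x ^ (2 * a)) with hg
  have hgm : Measurable[ℱ n] g := ((measurable_condSqrt n).pow_const (2 * a)).ennreal_ofReal
  set V : Ω → ℝ≥0∞ := fun x => ENNReal.ofReal (w x) ^ (-a)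
  have hV : AEMeasurable V μ := hw.aemeasurable_ofReal.pow_const _
  have hbern : (fun _ => ENNReal.ofReal (1 + 2 * a)) ≤ᵐ[μ] (fun x => V x * g x) +
      fun x => sqrtWeight w x * ENNReal.ofReal (2 * a / condSqrt μ ℱ w n x) := by
    filter_upwards [hw.pos, hw.condSqrt_pos (ℱ := ℱ) n] with x hx ht
    have hs := Real.sqrt_pos.2 hx
    simp only [Pi.add_apply, V, hg, sqrtWeight]
    rw [ENNReal.ofReal_rpow_of_pos hx, ← ENNReal.ofReal_mul (by positivity),
      ← ENNReal.ofReal_mul (by positivity), ← ENNReal.ofReal_add (by positivity) (by positivity)]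
    refine ENNReal.ofReal_le_ofReal ?_
    refine (one_add_le_rpow_neg_add (r := √(w x) / condSqrt μ ℱ w n x) (b := 2 * a)
      (by positivity) (by positivity)).trans_eq ?_
    rw [Real.div_rpow hs.le ht.le, Real.rpow_neg ht.le, div_inv_eq_mul]
    congr 1
    · congr 1
      rw [Real.sqrt_eq_rpow, ← Real.rpow_mul hx.le]
      congr 1
      ring
    · ring
  filter_upwards [condLExp_mono (mΩ := ℱ n) hbern,
    condLExp_add_left (mΩ := ℱ n) (P := μ) (X := fun x => V x * g x)
      (fun x => sqrtWeight w x * ENNReal.ofReal (2 * a / condSqrt μ ℱ w n x))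
      (hV.mul (hgm.mono (ℱ.le n) le_rfl).aemeasurable),
    condLExp_mul_of_measurable_right (ℱ.le n) hV hgm,
    hw.condLExp_sqrtWeight_mul_inv (ℱ := ℱ) n (b := 2 * a),
    hw.condSqrt_pos (ℱ := ℱ) n, hw.ofReal_condSqrt (ℱ := ℱ) n, hC n] with x h1 h2 h3 h4 h5 h6 h7
  rw [condLExp_const (ℱ.le n), h2, Pi.add_apply, h3, h4,
    ENNReal.ofReal_add zero_le_one (by positivity),
    ENNReal.add_le_add_iff_right ENNReal.ofReal_ne_top, ENNReal.ofReal_one] at h1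
  rw [← h6]
  set t := condSqrt μ ℱ w n x
  have h8 : 1 ≤ condLExp (ℱ n) μ V x ^ (p - 1) * ENNReal.ofReal t ^ 2 := by
    calc (1 : ℝ≥0∞) = 1 ^ (p - 1) := by simp
      _ ≤ (condLExp (ℱ n) μ V x * g x) ^ (p - 1) := by gcongr
      _ = condLExp (ℱ n) μ V x ^ (p - 1) * ENNReal.ofReal t ^ 2 := by
        rw [ENNReal.mul_rpow_of_nonneg _ _ hp'.le]
        congr 1
        rw [← ENNReal.ofReal_pow h5.le]
        simp only [hg]
        rw [ENNReal.ofReal_rpow_of_pos (by positivity), ← Real.rpow_mul h5.le,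
          ← Real.rpow_natCast]
        congr 2
        rw [ha]
        field_simp
        simp
  calc ENNReal.ofReal (mart μ ℱ w n x)
      ≤ ENNReal.ofReal (mart μ ℱ w n x) *
          (condLExp (ℱ n) μ V x ^ (p - 1) * ENNReal.ofReal t ^ 2) := le_mul_of_one_le_right' h8
    _ ≤ C * ENNReal.ofReal t ^ 2 := by rw [← mul_assoc]; gcongr; exact h7

/-- Returns from a subtraction-free inequality in `[0, ∞]` to `EReal`. The case `N = ∞` is `E(log w
| F_n) = -∞`. -/
theorem coe_sub_coe_le_coe_of_add_le {P N : ℝ≥0∞} {r : ℝ} (hP : P ≠ ∞)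
    (h : P + ENNReal.ofReal (-r) ≤ N + ENNReal.ofReal r) : (P : EReal) - N ≤ (r : EReal) := by
  rcases eq_or_ne N ∞ with rfl | hN
  · simp [EReal.sub_top]
  lift P to ℝ≥0 using hP
  lift N to ℝ≥0 using hN
  have h' := ENNReal.toReal_mono (by finiteness) h
  rw [ENNReal.toReal_add (by finiteness) (by finiteness),
    ENNReal.toReal_add (by finiteness) (by finiteness), ENNReal.toReal_ofReal',
    ENNReal.toReal_ofReal'] at h'
  have h'' : (P : ℝ) - N ≤ r := by
    have hr := max_zero_sub_eq_self r
    simp only [ENNReal.coe_toReal] at h'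
    linarith [max_comm r 0, max_comm (-r) 0]
  change ((P : ℝ) : EReal) - ((N : ℝ) : EReal) ≤ r
  exact_mod_cast h''

/-- With `t = E(√w | F_n)`, `log(√w / t) ≤ √w / t - 1` integrates to `E(log w | F_n) ≤ 2 log t`,
whose exponential is `t²`. -/
theorem IsWeight.memAStar_of_memAExp (hw : IsWeight μ w) (h : MemAExp μ ℱ w) :
    MemAStar μ ℱ w := by
  obtain ⟨C, hC⟩ := h
  refine hw.memAStar_of_le_sq C fun n => ?_
  have hwm : AEMeasurable w μ := hw.integrable.aestronglyMeasurable.aemeasurable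
  have hpm : AEMeasurable (fun x => ENNReal.ofReal (Real.log (w x))) μ := hwm.log.ennreal_ofReal
  have hnm : AEMeasurable (fun x => ENNReal.ofReal (-Real.log (w x))) μ :=
    hwm.log.neg.ennreal_ofReal
  set R : Ω → ℝ := fun x => 2 * Real.log (condSqrt μ ℱ w n x) with hR
  have hRm : Measurable[ℱ n] R := (measurable_condSqrt n).log.const_mul 2
  have hRm₁ : Measurable[ℱ n] fun x => ENNReal.ofReal (R x) := hRm.ennreal_ofReal
  have hRm₂ : Measurable[ℱ n] fun x => 2 + ENNReal.ofReal (-R x) :=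
    hRm.neg.ennreal_ofReal.const_add 2
  -- This is `log w + 2 ≤ 2 √w / t + 2 log t`, with negative parts moved across so that every term
  -- lies in `[0, ∞]`; the 2 cancels after conditioning.
  have hlog : ((fun x => ENNReal.ofReal (Real.log (w x))) + fun x => 2 + ENNReal.ofReal (-R x))
      ≤ᵐ[μ] (fun x => ENNReal.ofReal (-Real.log (w x))) +
        ((fun x => sqrtWeight w x * ENNReal.ofReal (2 / condSqrt μ ℱ w n x)) +
          fun x => ENNReal.ofReal (R x)) := by
    filter_upwards [hw.pos, hw.condSqrt_pos (ℱ := ℱ) n] with x hx ht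
    have hs := Real.sqrt_pos.2 hx
    simp only [Pi.add_apply, sqrtWeight, hR]
    set t := condSqrt μ ℱ w n x
    have h1 := Real.log_le_sub_one_of_pos (div_pos hs ht)
    rw [Real.log_div hs.ne' ht.ne', Real.log_sqrt hx.le] at h1
    have e1 : √(w x) * (2 / t) = 2 * (√(w x) / t) := by ring
    rw [← ENNReal.ofReal_mul hs.le, e1, ← ENNReal.ofReal_ofNat 2]
    rw [← ENNReal.toReal_le_toReal (by finiteness) (by finiteness)]
    repeat rw [ENNReal.toReal_add (by finiteness) (by finiteness)]
    have h2 : 0 ≤ 2 * (√(w x) / t) := by positivity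
    simp only [ENNReal.toReal_ofReal', max_eq_left h2]
    have e2 := max_zero_sub_eq_self (Real.log (w x))
    have e3 := max_zero_sub_eq_self (2 * Real.log t)
    have e4 : max (2 : ℝ) 0 = 2 := by norm_num
    rw [e4]
    linarith [max_comm (Real.log (w x)) 0, max_comm (-Real.log (w x)) 0,
      max_comm (2 * Real.log t) 0, max_comm (-(2 * Real.log t)) 0]
  have hPfin : ∀ᵐ x ∂μ, condLExp (ℱ n) μ (fun x => ENNReal.ofReal (Real.log (w x))) x ≠ ∞ := by
    refine condLExp_ne_top (ne_of_lt (lt_of_le_of_lt (lintegral_mono_ae ?_)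
      hw.integrable.lintegral_lt_top))
    filter_upwards [hw.pos] with x hx
    exact ENNReal.ofReal_le_ofReal (Real.log_le_self hx.le)
  filter_upwards [condLExp_mono (mΩ := ℱ n) hlog,
    condLExp_add_left (mΩ := ℱ n) (P := μ) (fun x => 2 + ENNReal.ofReal (-R x)) hpm,
    condLExp_add_left (mΩ := ℱ n) (P := μ)
      ((fun x => sqrtWeight w x * ENNReal.ofReal (2 / condSqrt μ ℱ w n x)) +
          fun x => ENNReal.ofReal (R x)) hnm,
    condLExp_add_right (mΩ := ℱ n) (P := μ)
      (fun x => sqrtWeight w x * ENNReal.ofReal (2 / condSqrt μ ℱ w n x))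
      (hRm₁.mono (ℱ.le n) le_rfl).aemeasurable,
    hw.condLExp_sqrtWeight_mul_inv (ℱ := ℱ) n (b := 2), hPfin,
    hw.condSqrt_pos (ℱ := ℱ) n, hw.ofReal_condSqrt (ℱ := ℱ) n, hC n]
    with x h1 h2 h3 h4 h5 h6 h7 h8 h9
  rw [h2, h3, Pi.add_apply, Pi.add_apply, h4, Pi.add_apply, h5,
    condLExp_eq_self (ℱ.le n) μ hRm₁,
    condLExp_eq_self (ℱ.le n) μ hRm₂, ENNReal.ofReal_ofNat,
    add_left_comm, add_left_comm _ 2, ENNReal.add_le_add_iff_left (by simp)] at h1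
  have h10 : condLog μ ℱ n w x ≤ (R x : EReal) := coe_sub_coe_le_coe_of_add_le h6 h1
  have h11 := EReal.exp_monotone h10
  simp only [hR] at h11
  rw [EReal.exp_coe, two_mul, Real.exp_add, Real.exp_log h7, ENNReal.ofReal_mul h7.le, h8,
    ← sq] at h11
  exact h9.trans (by gcongr)

end SquareRootCondition

end MartingaleWeights

theorem theorem1p7 {Ω : Type*} {mΩ : MeasurableSpace Ω} (μ : Measure Ω) [IsProbabilityMeasure μ]
    (ℱ : Filtration ℕ mΩ) (w : Ω → ℝ) (hw : MartingaleWeights.IsWeight μ w) :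
    ((∃ p : ℝ, 1 < p ∧ MartingaleWeights.MemAp μ ℱ p w) → MartingaleWeights.MemAStar μ ℱ w) ∧
    ((∃ q : ℝ, 1 < q ∧ MartingaleWeights.MemRH μ ℱ q w) → MartingaleWeights.MemAStar μ ℱ w) ∧
    (MartingaleWeights.MemALog μ ℱ w → MartingaleWeights.MemAStar μ ℱ w) ∧
    (MartingaleWeights.MemAExp μ ℱ w → MartingaleWeights.MemAStar μ ℱ w) :=
  ⟨fun ⟨_, hp, h⟩ => hw.memAStar_of_memAp hp h, fun ⟨_, hq, h⟩ => hw.memAStar_of_memRH hq h,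
    hw.memAStar_of_memALog, hw.memAStar_of_memAExp⟩
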